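/- Let $\mathcal{A}=(L_1,\dots,L_{10})$ be an arrangement of $10$ pairwise distinct lines in the complex projective plane $\mathbb{CP}^2$. For two $10$-tuples $\mathcal{B}=(H_1,\dots,H_{10})$ and $\mathcal{B}'=(H_1',\dots,H_{10}')$ of lines, write $L(\mathcal{B})=L(\mathcal{B}')$ if $\dim\bigcap_{i\in S}H_i=\dim\bigcap_{i\in S}H_i'$ for every nonempty $S\subseteq\{1,\dots,10\}$ (with $\dim\emptyset=-1$). Let $$\mathcal{M}_{\mathcal{A}}=\{\mathcal{B}\in((\mathbb{CP}^2)^*)^{10} : L(\mathcal{B})=L(\mathcal{A})\}/PGL(3,\mathbb{C})$$ be the (ordered) moduli space of $\mathcal{A}$, with the quotient of the Zariski topology. If there is a point of $\mathbb{CP}^2$ of multiplicity at least $6$ in $\mathcal{A}$, i.e. lying on at least $6$ of the lines $L_1,\dots,L_{10}$, then $\mathcal{M}_{\mathcal{A}}$ is irreducible (in particular nonempty). -/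

import Mathlib

noncomputable section

namespace LineArrangement

open scoped LinearAlgebra.Projectivization MatrixGroups

/-- The complex projective plane `ℂℙ²`. -/
abbrev Plane : Type := ℙ ℂ (Fin 3 → ℂ)

/-- The dual plane `(ℂℙ²)^*`: a point of it is a line of `ℂℙ²`, given by a nonzero linear form
on `ℂ³` up to scalars. -/
abbrev DualPlane : Type := ℙ ℂ (Module.Dual ℂ (Fin 3 → ℂ))

/-- The two-dimensional linear subspace of `ℂ³` whose projectivization is the line `L`. -/
def lineSubmodule (L : DualPlane) : Submodule ℂ (Fin 3 → ℂ) := LinearMap.ker L.rep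

/-- The set of points of `ℂℙ²` lying on the line `L`. -/
def linePoints (L : DualPlane) : Set Plane := {p | p.rep ∈ lineSubmodule L}

/-- `((ℂℙ²)^*)ⁿ`, the space of ordered `n`-tuples of lines; it carries the Zariski topology. -/
def LineTuple (n : ℕ) : Type := Fin n → DualPlane

variable {n : ℕ}

/-- Homogeneous coordinates: `coords B (i, j)` is the coefficient of the `j`-th variable in the
chosen linear form defining the `i`-th line. -/
def coords (B : LineTuple n) (x : Fin n × Fin 3) : ℂ := (B x.1).rep (Pi.single x.2 1)

/-- `p` is homogeneous in each of the `n` groups of three variables separately. -/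
def IsMultihomogeneous (p : MvPolynomial (Fin n × Fin 3) ℂ) : Prop :=
  ∃ d : Fin n → ℕ,
    MvPolynomial.IsWeightedHomogeneous (fun x : Fin n × Fin 3 => (Pi.single x.1 1 : Fin n → ℕ)) p d

/-- The common zero locus in `((ℂℙ²)^*)ⁿ` of a set of multihomogeneous polynomials. -/
def zeroLocus (S : Set (MvPolynomial (Fin n × Fin 3) ℂ)) : Set (LineTuple n) :=
  {B | ∀ p ∈ S, MvPolynomial.eval (coords B) p = 0}

/-- Vanishing of a multihomogeneous polynomial does not depend on the choice of the linear forms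
defining the lines. -/
theorem eval_coords_eq_zero_iff {p : MvPolynomial (Fin n × Fin 3) ℂ} (hp : IsMultihomogeneous p)
    (B : LineTuple n) (f : Fin n → Module.Dual ℂ (Fin 3 → ℂ)) (hf : ∀ i, f i ≠ 0)
    (hB : ∀ i, B i = Projectivization.mk ℂ (f i) (hf i)) :
    MvPolynomial.eval (coords B) p = 0 ↔
      MvPolynomial.eval (fun x : Fin n × Fin 3 => f x.1 (Pi.single x.2 1)) p = 0 := by
  obtain ⟨d, hd⟩ := hp
  have h : ∀ i, ∃ a : ℂˣ, a • f i = (B i).rep := by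
    intro i
    rw [hB i]
    exact Projectivization.exists_smul_eq_mk_rep ℂ (f i) (hf i)
  choose a ha using h
  have key : MvPolynomial.eval (coords B) p = (∏ i, (a i : ℂ) ^ d i) *
      MvPolynomial.eval (fun x : Fin n × Fin 3 => f x.1 (Pi.single x.2 1)) p := by
    rw [MvPolynomial.eval_eq, MvPolynomial.eval_eq, Finset.mul_sum]
    refine Finset.sum_congr rfl fun m hm => ?_
    have hw := hd (MvPolynomial.mem_support_iff.mp hm)
    have hdi : ∀ i, d i = ∑ j : Fin 3, m (i, j) := by
      intro i
      rw [← hw, Finsupp.weight_apply, Finsupp.sum_fintype _ _ (by simp), Finset.sum_apply,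
        Fintype.sum_prod_type, Finset.sum_eq_single i]
      · simp
      · intro k _ hk
        simp [Ne.symm hk]
      · simp
    have hc : ∀ x, coords B x = (a x.1 : ℂ) * f x.1 (Pi.single x.2 1) := by
      intro x
      simp [coords, ← ha x.1, Units.smul_def]
    have hprod : ∏ x ∈ m.support, coords B x ^ m x = (∏ i, (a i : ℂ) ^ d i) *
        ∏ x ∈ m.support, f x.1 (Pi.single x.2 1) ^ m x := by
      have e1 : ∀ g : Fin n × Fin 3 → ℂ, ∏ x ∈ m.support, g x ^ m x = ∏ x, g x ^ m x := by
        intro g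
        exact Finset.prod_subset (Finset.subset_univ _) (by
          intro x _ hx
          simp [Finsupp.notMem_support_iff.mp hx])
      rw [e1, e1 (fun x => f x.1 (Pi.single x.2 1))]
      simp only [hc, mul_pow, Finset.prod_mul_distrib]
      congr 1
      rw [Fintype.prod_prod_type]
      refine Finset.prod_congr rfl fun i _ => ?_
      simp only [hdi i, Finset.prod_pow_eq_pow_sum]
    rw [hprod]
    ring
  have hne : (∏ i, (a i : ℂ) ^ d i) ≠ 0 :=
    Finset.prod_ne_zero_iff.mpr fun i _ => pow_ne_zero _ (a i).ne_zero
  rw [key, mul_eq_zero, or_iff_right hne]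

/-- The Zariski topology on `((ℂℙ²)^*)ⁿ`: the closed sets are the common zero loci of sets of
multihomogeneous polynomials. -/
instance zariskiTopology : TopologicalSpace (LineTuple n) :=
  TopologicalSpace.ofClosed
    {Z | ∃ S : Set (MvPolynomial (Fin n × Fin 3) ℂ),
      (∀ p ∈ S, IsMultihomogeneous p) ∧ Z = zeroLocus S}
    (by
      refine ⟨{1}, ?_, ?_⟩
      · rintro p rfl
        exact ⟨0, MvPolynomial.isWeightedHomogeneous_one _ _⟩
      · ext B
        simp [zeroLocus])
    (by
      intro A hA
      have hA' : ∀ Z ∈ A, ∃ S : Set (MvPolynomial (Fin n × Fin 3) ℂ),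
          (∀ p ∈ S, IsMultihomogeneous p) ∧ Z = zeroLocus S := fun Z h => hA h
      choose! S hS hZ using hA'
      refine ⟨⋃ Z ∈ A, S Z, ?_, ?_⟩
      · intro p hp
        simp only [Set.mem_iUnion] at hp
        obtain ⟨Z, hZA, hp⟩ := hp
        exact hS Z hZA p hp
      · ext B
        simp only [Set.mem_sInter, zeroLocus, Set.mem_ofPred_eq, Set.mem_iUnion]
        constructor
        · rintro h p ⟨Z, hZA, hp⟩
          have hB := h Z hZA
          rw [hZ Z hZA] at hB
          exact hB p hp
        · intro h Z hZA
          rw [hZ Z hZA]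
          exact fun p hp => h p ⟨Z, hZA, hp⟩)
    (by
      rintro _ ⟨S, hS, rfl⟩ _ ⟨T, hT, rfl⟩
      refine ⟨{r | ∃ p ∈ S, ∃ q ∈ T, r = p * q}, ?_, ?_⟩
      · rintro _ ⟨p, hp, q, hq, rfl⟩
        obtain ⟨d, hd⟩ := hS p hp
        obtain ⟨e, he⟩ := hT q hq
        exact ⟨d + e, hd.mul he⟩
      · ext B
        constructor
        · rintro (h | h) _ ⟨p, hp, q, hq, rfl⟩
          · rw [map_mul, h p hp, zero_mul]
          · rw [map_mul, h q hq, mul_zero]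
        · intro h
          by_contra hcon
          simp only [zeroLocus, Set.mem_union, Set.mem_ofPred_eq, not_or, not_forall] at hcon
          obtain ⟨⟨p, hp, hp0⟩, ⟨q, hq, hq0⟩⟩ := hcon
          have := h (p * q) ⟨p, hp, q, hq, rfl⟩
          rw [map_mul, mul_eq_zero] at this
          exact this.elim hp0 hq0)

/-- The multiplicity of the point `p` in the arrangement `A`: the number of lines through `p`. -/
def multiplicity (A : LineTuple n) (p : Plane) : ℕ := {i | p ∈ linePoints (A i)}.ncard

/-- `L(A) = L(B)`: for every nonempty set `S` of indices, the intersections of the lines indexed by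
`S` in `A` and in `B` have the same dimension. (The projective dimension is the linear one minus
one, the empty set having dimension `-1`.) -/
def SameLattice (A B : LineTuple n) : Prop :=
  ∀ S : Finset (Fin n), S.Nonempty →
    Module.finrank ℂ (⨅ i ∈ S, lineSubmodule (A i) : Submodule ℂ (Fin 3 → ℂ)) =
      Module.finrank ℂ (⨅ i ∈ S, lineSubmodule (B i) : Submodule ℂ (Fin 3 → ℂ))

/-- The space `{B ∈ ((ℂℙ²)^*)ⁿ | L(B) = L(A)}`, with the Zariski topology induced from
`((ℂℙ²)^*)ⁿ`. -/
abbrev RealizationSpace (A : LineTuple n) : Type := {B : LineTuple n // SameLattice B A}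

/-- Two tuples of lines are projectively equivalent if an element of `PGL(3, ℂ)`, acting on
`ℂℙ²`, carries the `i`-th line of the first onto the `i`-th line of the second for every `i`. -/
def projectiveSetoid (A : LineTuple n) : Setoid (RealizationSpace A) where
  r B C := ∃ g : PGL(3, ℂ), ∀ i,
    (fun p : Plane => g • p) '' linePoints (B.1 i) = linePoints (C.1 i)
  iseqv :=
    { refl := fun B => ⟨1, fun i => by simp⟩
      symm := by
        rintro B C ⟨g, hg⟩
        refine ⟨g⁻¹, fun i => ?_⟩
        rw [← hg i, Set.image_image]
        simp
      trans := by
        rintro B C D ⟨g, hg⟩ ⟨h, hh⟩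
        refine ⟨h * g, fun i => ?_⟩
        rw [← hh i, ← hg i, Set.image_image]
        simp [mul_smul] }

/-- The (ordered) moduli space `M_A = {B ∈ ((ℂℙ²)^*)ⁿ | L(B) = L(A)} / PGL(3, ℂ)`, with the
quotient of the Zariski topology. -/
abbrev ModuliSpace (A : LineTuple n) : Type := Quotient (projectiveSetoid A)

end LineArrangement

end

/-!
Write every line through its vector of coefficients. Given two realizations, it is enough to choose
representatives `v`, `v'` of their projective classes such that every concurrence in `v` persists
along the segment `t ↦ (1 - t) v + t v'`: no further concurrence occurs for all but finitely many
`t`, so a generic point of the segment lies in any given neighbourhoods of both ends, and any two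
nonempty open sets of the moduli space meet.

Let `u` span the multiple point, moved to the same place in both realizations, and scale the lines
off it to take the value `1` at `u`. There are at most four of these. If they are concurrent at a
point spanned by `x`, matching `u` and `x` in both realizations makes every difference `v'ᵢ - vᵢ`
vanish at `u` and at `x`, hence proportional to `u × x`. If they are not concurrent, three of them
can be matched by a change of coordinates, which then matches `u` because `u` is determined by the
values of the three at it, and only the fourth moves. In both cases all lines off `u` move in a
single direction `m`. A line through `u` and the intersection of two lines `a`, `b`
off `u` is proportional to `a - b`, so after rescaling it moves in the direction `m` too. Along a
family moving in a single direction the determinant of three lines is affine in `t`, so it vanishes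
identically once it vanishes at both ends.
-/

namespace LineArrangement

open Filter Topology
open scoped LinearAlgebra.Projectivization MatrixGroups Matrix

section CrossProduct

variable {K : Type*} [Field K]

theorem mem_span_singleton_of_cross_eq_zero {a b : Fin 3 → K} (ha : a ≠ 0) (h : a ⨯₃ b = 0) :
    b ∈ K ∙ a := by
  by_contra hb
  refine crossProduct_ne_zero_iff_linearIndependent.mpr ((LinearIndependent.pair_iff' ha).mpr ?_) h
  exact fun c hc => hb (Submodule.mem_span_singleton.mpr ⟨c, hc⟩)

theorem mem_span_cross_iff {a b x : Fin 3 → K} (h : a ⨯₃ b ≠ 0) :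
    x ∈ K ∙ (a ⨯₃ b) ↔ a ⬝ᵥ x = 0 ∧ b ⬝ᵥ x = 0 := by
  constructor
  · intro hx
    obtain ⟨c, rfl⟩ := Submodule.mem_span_singleton.mp hx
    simp
  · rintro ⟨ha, hb⟩
    refine mem_span_singleton_of_cross_eq_zero h ?_
    simp [cross_cross_eq_smul_sub_smul, ha, hb]

theorem dotProduct_cross_eq_zero_iff {a b c : Fin 3 → K} :
    a ⬝ᵥ b ⨯₃ c = 0 ↔ ∃ x ≠ 0, a ⬝ᵥ x = 0 ∧ b ⬝ᵥ x = 0 ∧ c ⬝ᵥ x = 0 := by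
  rw [triple_product_eq_det]
  refine (Matrix.exists_mulVec_eq_zero_iff (M := Matrix.of ![a, b, c])).symm.trans ?_
  simp [Matrix.cons_mulVec, funext_iff, Fin.forall_fin_succ]

theorem exists_ne_zero_forall_dotProduct_eq_zero_iff {S : Set (Fin 3 → K)} :
    (∃ x ≠ 0, ∀ a ∈ S, a ⬝ᵥ x = 0) ↔ ∀ a ∈ S, ∀ b ∈ S, ∀ c ∈ S, a ⬝ᵥ b ⨯₃ c = 0 := by
  constructor
  · rintro ⟨x, hx, hS⟩ a ha b hb c hc
    exact dotProduct_cross_eq_zero_iff.mpr ⟨x, hx, hS a ha, hS b hb, hS c hc⟩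
  · intro hS
    by_cases hspan : Submodule.span K S = ⊤
    · have hbasis := Submodule.exists_fun_fin_finrank_span_eq K S
      rw [hspan, finrank_top, Module.finrank_fin_fun] at hbasis
      obtain ⟨f, hfS, -, hf⟩ := hbasis
      have hrows : LinearIndependent K ![f 0, f 1, f 2] := (FinVec.etaExpand_eq f).symm ▸ hf
      have hunit := Matrix.linearIndependent_rows_iff_isUnit (A := Matrix.of _).mp hrows
      refine absurd (hS _ (hfS 0) _ (hfS 1) _ (hfS 2)) ?_
      rw [triple_product_eq_det]
      exact ((Matrix.isUnit_iff_isUnit_det _).mp hunit).ne_zero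
    · obtain ⟨φ, hφ, hker⟩ := Submodule.exists_le_ker_of_lt_top _ (lt_top_iff_ne_top.mpr hspan)
      refine ⟨(dotProductEquiv K (Fin 3)).symm φ, by simpa using hφ, fun a ha => ?_⟩
      have haφ : φ a = 0 := hker (Submodule.subset_span ha)
      rwa [← (dotProductEquiv K (Fin 3)).apply_symm_apply φ, dotProductEquiv_apply_apply,
        dotProduct_comm] at haφ

theorem exists_units_smul_sub_eq {u l a b : Fin 3 → K} (hl : l ≠ 0) (hlu : l ⬝ᵥ u = 0)
    (ha : a ⬝ᵥ u = 1) (hb : b ⬝ᵥ u = 1) (hab : a ⨯₃ b ≠ 0) (h : l ⬝ᵥ a ⨯₃ b = 0) :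
    ∃ c : Kˣ, c • (a - b) = l := by
  have hsub : u ⨯₃ (a ⨯₃ b) = a - b := by
    rw [cross_cross_eq_smul_sub_smul', dotProduct_comm u, ha, hb, one_smul, one_smul]
  have hne : u ⨯₃ (a ⨯₃ b) ≠ 0 := by
    rw [hsub, sub_ne_zero]
    rintro rfl
    exact hab (cross_self a)
  have hmem : l ∈ K ∙ (u ⨯₃ (a ⨯₃ b)) :=
    (mem_span_cross_iff hne).mpr ⟨by rwa [dotProduct_comm], by rwa [dotProduct_comm]⟩
  rw [hsub] at hmem
  obtain ⟨c, rfl⟩ := Submodule.mem_span_singleton.mp hmem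
  exact ⟨Units.mk0 c (left_ne_zero_of_smul hl), rfl⟩

theorem dotProduct_cross_lineMap_eq_zero {R : Type*} [CommRing R] {m a b c a' b' c' : Fin 3 → R}
    (ha : a' - a ∈ R ∙ m) (hb : b' - b ∈ R ∙ m) (hc : c' - c ∈ R ∙ m)
    (h : a ⬝ᵥ b ⨯₃ c = 0) (h' : a' ⬝ᵥ b' ⨯₃ c' = 0) (t : R) :
    AffineMap.lineMap a a' t ⬝ᵥ AffineMap.lineMap b b' t ⨯₃ AffineMap.lineMap c c' t = 0 := by
  simp only [Submodule.mem_span_singleton, eq_sub_iff_add_eq'] at ha hb hc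
  obtain ⟨⟨r, rfl⟩, ⟨s, rfl⟩, ⟨q, rfl⟩⟩ := ha, hb, hc
  -- The coefficients of `t ^ 2` and `t ^ 3` are sums of determinants with two rows proportional
  -- to `m`.
  have haffine : AffineMap.lineMap a (a + r • m) t ⬝ᵥ AffineMap.lineMap b (b + s • m) t ⨯₃
      AffineMap.lineMap c (c + q • m) t =
        (1 - t) * (a ⬝ᵥ b ⨯₃ c) + t * ((a + r • m) ⬝ᵥ (b + s • m) ⨯₃ (c + q • m)) := by
    simp only [AffineMap.lineMap_apply, vsub_eq_sub, add_sub_cancel_left, vadd_eq_add,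
      Matrix.vec3_dotProduct, cross_apply, Matrix.cons_val, Pi.add_apply, Pi.smul_apply,
      smul_eq_mul]
    ring
  rw [haffine, h, h', mul_zero, mul_zero, add_zero]

end CrossProduct

section Incidences

variable {ι K : Type*} [Field K] {v v' : ι → Fin 3 → K} {P : Set ι} {u u' m : Fin 3 → K}

/-- Two families of linear equations of lines in a projective plane have the same incidences if the
same triples of lines are concurrent. -/
def SameIncidences (v w : ι → Fin 3 → K) : Prop :=
  ∀ i j k, v i ⬝ᵥ v j ⨯₃ v k = 0 ↔ w i ⬝ᵥ w j ⨯₃ w k = 0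

/-- A family of linear equations is normalized at a vector `u` spanning the point through which
exactly the lines indexed by `P` pass if all the other equations take the value `1` at `u`. -/
structure NormalizedAt (P : Set ι) (u : Fin 3 → K) (v : ι → Fin 3 → K) : Prop where
  dotProduct_eq_zero : ∀ i ∈ P, v i ⬝ᵥ u = 0
  dotProduct_eq_one : ∀ i ∉ P, v i ⬝ᵥ u = 1

theorem NormalizedAt.mem_of_dotProduct_cross_eq_zero (hv : NormalizedAt P u v) {i j k : ι}
    (hi : i ∈ P) (hj : j ∈ P) (hij : v i ⨯₃ v j ≠ 0) (h : v k ⬝ᵥ v i ⨯₃ v j = 0) : k ∈ P := by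
  by_contra hk
  obtain ⟨c, rfl⟩ := Submodule.mem_span_singleton.mp
    ((mem_span_cross_iff hij).mpr ⟨hv.dotProduct_eq_zero i hi, hv.dotProduct_eq_zero j hj⟩)
  simpa [h] using hv.dotProduct_eq_one k hk

theorem NormalizedAt.exists_units_smul_sub_mem_span (hv : NormalizedAt P u v)
    (hv' : NormalizedAt P u' v') (hcross : Pairwise fun i j => v i ⨯₃ v j ≠ 0)
    (hcross' : Pairwise fun i j => v' i ⨯₃ v' j ≠ 0) (hvv' : SameIncidences v v') {i a b : ι}
    (hi : i ∈ P) (ha : a ∉ P) (hb : b ∉ P) (hab : a ≠ b) (h : v i ⬝ᵥ v a ⨯₃ v b = 0)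
    (ham : v' a - v a ∈ K ∙ m) (hbm : v' b - v b ∈ K ∙ m) :
    ∃ c : Kˣ, c • v' i - v i ∈ K ∙ m := by
  have hia : i ≠ a := ne_of_mem_of_not_mem hi ha
  have ne_zero_of_cross {x y : Fin 3 → K} (hxy : x ⨯₃ y ≠ 0) : x ≠ 0 := by
    rintro rfl
    simp at hxy
  obtain ⟨c, hc⟩ := exists_units_smul_sub_eq (ne_zero_of_cross (hcross hia))
    (hv.dotProduct_eq_zero i hi) (hv.dotProduct_eq_one a ha) (hv.dotProduct_eq_one b hb)
    (hcross hab) h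
  obtain ⟨c', hc'⟩ := exists_units_smul_sub_eq (ne_zero_of_cross (hcross' hia))
    (hv'.dotProduct_eq_zero i hi) (hv'.dotProduct_eq_one a ha) (hv'.dotProduct_eq_one b hb)
    (hcross' hab) ((hvv' i a b).mp h)
  refine ⟨c / c', ?_⟩
  rw [← hc, ← hc', smul_smul, div_mul_cancel, ← smul_sub, sub_sub_sub_comm]
  exact Submodule.smul_mem _ (c : K) (sub_mem ham hbm)

theorem NormalizedAt.exists_units_forall_smul_sub_mem_span (hv : NormalizedAt P u v)
    (hv' : NormalizedAt P u' v') (hcross : Pairwise fun i j => v i ⨯₃ v j ≠ 0)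
    (hcross' : Pairwise fun i j => v' i ⨯₃ v' j ≠ 0) (hvv' : SameIncidences v v')
    (hm : ∀ i ∉ P, v' i - v i ∈ K ∙ m) :
    ∃ c : ι → Kˣ, ∀ i j k, i ≠ j → j ≠ k → k ≠ i → ¬(i ∈ P ∧ j ∈ P ∧ k ∈ P) →
      v i ⬝ᵥ v j ⨯₃ v k = 0 → c i • v' i - v i ∈ K ∙ m := by
  have hscale (i : ι) : ∃ c : Kˣ,
      (i ∈ P → ∃ a ∉ P, ∃ b ∉ P, a ≠ b ∧ v i ⬝ᵥ v a ⨯₃ v b = 0) → c • v' i - v i ∈ K ∙ m := by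
    by_cases hi : i ∈ P
    · by_cases hab : ∃ a ∉ P, ∃ b ∉ P, a ≠ b ∧ v i ⬝ᵥ v a ⨯₃ v b = 0
      · obtain ⟨a, ha, b, hb, hab, h⟩ := hab
        obtain ⟨c, hc⟩ := hv.exists_units_smul_sub_mem_span hv' hcross hcross' hvv' hi ha hb hab h
          (hm a ha) (hm b hb)
        exact ⟨c, fun _ => hc⟩
      · exact ⟨1, fun h => absurd (h hi) hab⟩
    · exact ⟨1, fun _ => by simpa using hm i hi⟩
  choose c hc using hscale
  refine ⟨c, fun i j k hij hjk hki hP h =>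
    hc i fun hi => ⟨j, fun hj => ?_, k, fun hk => ?_, hjk, h⟩⟩
  · refine hP ⟨hi, hj, hv.mem_of_dotProduct_cross_eq_zero hi hj (hcross hij) ?_⟩
    rwa [triple_product_permutation]
  · refine hP ⟨hi, hv.mem_of_dotProduct_cross_eq_zero hk hi (hcross hki) ?_, hk⟩
    rwa [triple_product_permutation, triple_product_permutation]

theorem NormalizedAt.exists_units_smul_lineMap (hu : u ≠ 0) (hv : NormalizedAt P u v)
    (hv' : NormalizedAt P u v') (hcross : Pairwise fun i j => v i ⨯₃ v j ≠ 0)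
    (hcross' : Pairwise fun i j => v' i ⨯₃ v' j ≠ 0) (hvv' : SameIncidences v v')
    (hm : ∀ i ∉ P, v' i - v i ∈ K ∙ m) :
    ∃ c : ι → Kˣ, ∀ i j k, v i ⬝ᵥ v j ⨯₃ v k = 0 → ∀ t : K,
      AffineMap.lineMap (v i) (c i • v' i) t ⬝ᵥ AffineMap.lineMap (v j) (c j • v' j) t ⨯₃
        AffineMap.lineMap (v k) (c k • v' k) t = 0 := by
  obtain ⟨c, hc⟩ := hv.exists_units_forall_smul_sub_mem_span hv' hcross hcross' hvv' hm
  refine ⟨c, fun i j k h t => ?_⟩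
  obtain rfl | hij := eq_or_ne i j
  · exact dot_self_cross _ _
  obtain rfl | hjk := eq_or_ne j k
  · rw [cross_self, dotProduct_zero]
  obtain rfl | hki := eq_or_ne k i
  · exact dot_cross_self _ _
  by_cases hP : i ∈ P ∧ j ∈ P ∧ k ∈ P
  · have hPu (l : ι) (hl : l ∈ P) : AffineMap.lineMap (v l) (c l • v' l) t ⬝ᵥ u = 0 := by
      simp [AffineMap.lineMap_apply_module, add_dotProduct, smul_dotProduct, Units.smul_def,
        hv.dotProduct_eq_zero l hl, hv'.dotProduct_eq_zero l hl]
    exact dotProduct_cross_eq_zero_iff.mpr ⟨u, hu, hPu i hP.1, hPu j hP.2.1, hPu k hP.2.2⟩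
  · have hjki : v j ⬝ᵥ v k ⨯₃ v i = 0 := (triple_product_permutation _ _ _).symm.trans h
    have hkij : v k ⬝ᵥ v i ⨯₃ v j = 0 := (triple_product_permutation _ _ _).trans h
    refine dotProduct_cross_lineMap_eq_zero (hc i j k hij hjk hki hP h)
      (hc j k i hjk hki hij (by tauto) hjki) (hc k i j hki hij hjk (by tauto) hkij) h ?_ t
    simp [Units.smul_def, smul_dotProduct, (hvv' i j k).mp h]

end Incidences

section CoordinateChange

variable {ι K : Type*} [Field K] {v v' : ι → Fin 3 → K} {P : Set ι} {u u' x x' : Fin 3 → K}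

theorem exists_generalLinearGroup_vecMul_eq {a b c a' b' c' : Fin 3 → K}
    (h : a ⬝ᵥ b ⨯₃ c ≠ 0) (h' : a' ⬝ᵥ b' ⨯₃ c' ≠ 0) :
    ∃ g : GL (Fin 3) K, a ᵥ* g.1 = a' ∧ b ᵥ* g.1 = b' ∧ c ᵥ* g.1 = c' := by
  rw [triple_product_eq_det] at h h'
  let N : GL (Fin 3) K := Matrix.GeneralLinearGroup.mkOfDetNeZero _ h
  let N' : GL (Fin 3) K := Matrix.GeneralLinearGroup.mkOfDetNeZero _ h'
  have hrow (i : Fin 3) : N.1 i ᵥ* (N⁻¹ * N').1 = N'.1 i := by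
    rw [← Matrix.mul_apply_eq_vecMul, ← Units.val_mul, mul_inv_cancel_left]
  exact ⟨N⁻¹ * N', hrow 0, hrow 1, hrow 2⟩

theorem exists_dotProduct_ne_zero {κ R : Type*} [Fintype κ] [CommSemiring R] {a : κ → R}
    (ha : a ≠ 0) : ∃ b, b ⬝ᵥ a ≠ 0 := by
  by_contra! h
  exact ha (dotProduct_eq_zero _ fun b => (dotProduct_comm _ _).trans (h b))

theorem exists_generalLinearGroup_mulVec_eq (h : u ⨯₃ x ≠ 0) (h' : u' ⨯₃ x' ≠ 0) :
    ∃ g : GL (Fin 3) K, g.1 *ᵥ u = u' ∧ g.1 *ᵥ x = x' := by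
  obtain ⟨w, hw⟩ := exists_dotProduct_ne_zero h
  obtain ⟨w', hw'⟩ := exists_dotProduct_ne_zero h'
  obtain ⟨g, -, hgu, hgx⟩ := exists_generalLinearGroup_vecMul_eq hw hw'
  have hdet : g.1ᵀ.det ≠ 0 := by
    rw [Matrix.det_transpose]
    exact g.det_ne_zero
  refine ⟨Matrix.GeneralLinearGroup.mkOfDetNeZero _ hdet, ?_, ?_⟩
  · exact (Matrix.mulVec_transpose _ _).trans hgu
  · exact (Matrix.mulVec_transpose _ _).trans hgx

theorem NormalizedAt.vecMul (hv : NormalizedAt P u v) {g : Matrix (Fin 3) (Fin 3) K}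
    (hg : g *ᵥ u' = u) : NormalizedAt P u' fun i => v i ᵥ* g where
  dotProduct_eq_zero i hi := by rw [← Matrix.dotProduct_mulVec, hg, hv.dotProduct_eq_zero i hi]
  dotProduct_eq_one i hi := by rw [← Matrix.dotProduct_mulVec, hg, hv.dotProduct_eq_one i hi]

theorem NormalizedAt.exists_cross_ne_zero_of_concurrent (hv : NormalizedAt P u v) (hu : u ≠ 0)
    (hconc : ∀ i ∉ P, ∀ j ∉ P, ∀ k ∉ P, v i ⬝ᵥ v j ⨯₃ v k = 0) :
    ∃ x, u ⨯₃ x ≠ 0 ∧ ∀ i ∉ P, v i ⬝ᵥ x = 0 := by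
  by_cases hP : ∃ i, i ∉ P
  · obtain ⟨a, ha⟩ := hP
    obtain ⟨x, hx, hvx⟩ := exists_ne_zero_forall_dotProduct_eq_zero_iff (S := v '' Pᶜ).mpr
      (by simpa only [Set.forall_mem_image, Set.mem_compl_iff] using @hconc)
    rw [Set.forall_mem_image] at hvx
    refine ⟨x, fun hux => hx ?_, fun i hi => hvx hi⟩
    obtain ⟨c, rfl⟩ := Submodule.mem_span_singleton.mp (mem_span_singleton_of_cross_eq_zero hu hux)
    have hc : c = 0 := by simpa [hv.dotProduct_eq_one a ha] using hvx ha
    rw [hc, zero_smul]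
  · obtain ⟨x, hx⟩ := exists_linearIndependent_pair_of_one_lt_finrank (R := K) (by simp) hu
    exact ⟨x, crossProduct_ne_zero_iff_linearIndependent.mpr hx, fun i hi => absurd ⟨i, hi⟩ hP⟩

theorem NormalizedAt.exists_generalLinearGroup_of_concurrent (hv : NormalizedAt P u v)
    (hv' : NormalizedAt P u' v') (hu : u ≠ 0) (hu' : u' ≠ 0)
    (hconc : ∀ i ∉ P, ∀ j ∉ P, ∀ k ∉ P, v i ⬝ᵥ v j ⨯₃ v k = 0)
    (hconc' : ∀ i ∉ P, ∀ j ∉ P, ∀ k ∉ P, v' i ⬝ᵥ v' j ⨯₃ v' k = 0) :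
    ∃ g : GL (Fin 3) K, g.1 *ᵥ u' = u ∧ ∃ m, ∀ i ∉ P, v' i - v i ᵥ* g.1 ∈ K ∙ m := by
  obtain ⟨x, hux, hvx⟩ := hv.exists_cross_ne_zero_of_concurrent hu hconc
  obtain ⟨x', hux', hvx'⟩ := hv'.exists_cross_ne_zero_of_concurrent hu' hconc'
  obtain ⟨g, hgu, hgx⟩ := exists_generalLinearGroup_mulVec_eq hux' hux
  refine ⟨g, hgu, u' ⨯₃ x', fun i hi => (mem_span_cross_iff hux').mpr ⟨?_, ?_⟩⟩
  · rw [dotProduct_comm, sub_dotProduct, hv'.dotProduct_eq_one i hi,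
      (hv.vecMul hgu).dotProduct_eq_one i hi, sub_self]
  · rw [dotProduct_comm, sub_dotProduct, hvx' i hi, ← Matrix.dotProduct_mulVec, hgx, hvx i hi,
      sub_self]

theorem exists_subset_insert_of_encard_le {α : Type*} [Nonempty α] {s t : Set α} (hts : t ⊆ s)
    (ht : t.Finite) (h : s.encard ≤ t.encard + 1) : ∃ d, s ⊆ insert d t := by
  rw [← Set.encard_sdiff_add_encard_of_subset hts, add_comm,
    ENat.add_le_add_iff_left (Set.encard_ne_top_iff.mpr ht), Set.encard_le_one_iff_eq] at h
  simp only [Set.insert_eq, Set.union_comm _ t, ← Set.sdiff_subset_iff]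
  obtain h | ⟨d, h⟩ := h
  · exact ⟨Classical.arbitrary α, h.trans_subset (Set.empty_subset _)⟩
  · exact ⟨d, h.subset⟩

theorem NormalizedAt.exists_generalLinearGroup_of_independent (hv : NormalizedAt P u v)
    (hv' : NormalizedAt P u' v') (hP : Pᶜ.encard ≤ 4) {a b c : ι} (ha : a ∉ P) (hb : b ∉ P)
    (hc : c ∉ P) (h : v a ⬝ᵥ v b ⨯₃ v c ≠ 0) (h' : v' a ⬝ᵥ v' b ⨯₃ v' c ≠ 0) :
    ∃ g : GL (Fin 3) K, g.1 *ᵥ u' = u ∧ ∃ m, ∀ i ∉ P, v' i - v i ᵥ* g.1 ∈ K ∙ m := by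
  obtain ⟨g, hga, hgb, hgc⟩ := exists_generalLinearGroup_vecMul_eq h h'
  have horth {i : ι} (hi : i ∉ P) (hgi : v i ᵥ* g.1 = v' i) : v i ⬝ᵥ (g.1 *ᵥ u' - u) = 0 := by
    rw [dotProduct_sub, Matrix.dotProduct_mulVec, hgi, hv'.dotProduct_eq_one i hi,
      hv.dotProduct_eq_one i hi, sub_self]
  have hgu : g.1 *ᵥ u' = u := by
    by_contra hne
    exact h (dotProduct_cross_eq_zero_iff.mpr
      ⟨_, sub_ne_zero.mpr hne, horth ha hga, horth hb hgb, horth hc hgc⟩)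
  obtain ⟨d, hd⟩ : ∃ d, Pᶜ ⊆ {d, a, b, c} := by
    have : Nonempty ι := ⟨a⟩
    have hab : a ≠ b := by
      rintro rfl
      exact h (dot_self_cross _ _)
    have hac : a ≠ c := by
      rintro rfl
      exact h (dot_cross_self _ _)
    have hbc : b ≠ c := by
      rintro rfl
      exact h (by rw [cross_self, dotProduct_zero])
    refine exists_subset_insert_of_encard_le ?_ (Set.toFinite _) (hP.trans_eq ?_)
    · rintro i (rfl | rfl | rfl) <;> assumption
    · rw [Set.encard_eq_three.mpr ⟨a, b, c, hab, hac, hbc, rfl⟩]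
      norm_num
  refine ⟨g, hgu, v' d - v d ᵥ* g.1, fun i hi => ?_⟩
  obtain rfl | rfl | rfl | rfl := hd hi
  · exact Submodule.mem_span_singleton_self _
  · rw [hga, sub_self]
    exact zero_mem _
  · rw [hgb, sub_self]
    exact zero_mem _
  · rw [hgc, sub_self]
    exact zero_mem _

theorem NormalizedAt.exists_generalLinearGroup (hv : NormalizedAt P u v)
    (hv' : NormalizedAt P u' v') (hu : u ≠ 0) (hu' : u' ≠ 0) (hvv' : SameIncidences v v')
    (hP : Pᶜ.encard ≤ 4) :
    ∃ g : GL (Fin 3) K, g.1 *ᵥ u' = u ∧ ∃ m, ∀ i ∉ P, v' i - v i ᵥ* g.1 ∈ K ∙ m := by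
  by_cases hconc : ∀ i ∉ P, ∀ j ∉ P, ∀ k ∉ P, v i ⬝ᵥ v j ⨯₃ v k = 0
  · exact hv.exists_generalLinearGroup_of_concurrent hv' hu hu' hconc
      fun i hi j hj k hk => (hvv' i j k).mp (hconc i hi j hj k hk)
  · push Not at hconc
    obtain ⟨a, ha, b, hb, c, hc, h⟩ := hconc
    exact hv.exists_generalLinearGroup_of_independent hv' hP ha hb hc h (mt (hvv' a b c).mpr h)

end CoordinateChange

section Represents

variable {n : ℕ} {v w : Fin n → Fin 3 → ℂ} {B C : LineTuple n}

/-- The `i`-th line of `B` has the linear equation with coefficient vector `v i`. -/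
def Represents (v : Fin n → Fin 3 → ℂ) (B : LineTuple n) : Prop :=
  ∀ i, ∃ h : dotProductEquiv ℂ (Fin 3) (v i) ≠ 0, B i = Projectivization.mk ℂ _ h

theorem exists_represents (B : LineTuple n) : ∃ v, Represents v B := by
  refine ⟨fun i => (dotProductEquiv ℂ (Fin 3)).symm (B i).rep, fun i => ?_⟩
  simp only [LinearEquiv.apply_symm_apply]
  exact ⟨(B i).rep_nonzero, (B i).mk_rep.symm⟩

theorem exists_lineTuple_represents (hv : ∀ i, v i ≠ 0) : ∃ B : LineTuple n, Represents v B :=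
  ⟨fun i => Projectivization.mk ℂ (dotProductEquiv ℂ (Fin 3) (v i)) (by simpa using hv i),
    fun _ => ⟨_, rfl⟩⟩

theorem Represents.ne_zero (hv : Represents v B) (i : Fin n) : v i ≠ 0 := by
  simpa using (hv i).1

theorem Represents.units_smul (hv : Represents v B) (c : Fin n → ℂˣ) :
    Represents (fun i => c i • v i) B := by
  intro i
  obtain ⟨hi, hBi⟩ := hv i
  have hsmul : dotProductEquiv ℂ (Fin 3) (c i • v i) = c i • dotProductEquiv ℂ (Fin 3) (v i) :=
    map_smul _ (c i : ℂ) (v i)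
  rw [hsmul, hBi]
  refine ⟨(smul_ne_zero_iff_ne _).mpr hi, ?_⟩
  rw [Projectivization.mk_eq_mk_iff]
  exact ⟨(c i)⁻¹, inv_smul_smul _ _⟩

theorem Represents.mem_lineSubmodule_iff (hv : Represents v B) {i : Fin n} {x : Fin 3 → ℂ} :
    x ∈ lineSubmodule (B i) ↔ v i ⬝ᵥ x = 0 := by
  obtain ⟨hi, hBi⟩ := hv i
  obtain ⟨c, hc⟩ := Projectivization.exists_smul_eq_mk_rep ℂ _ hi
  rw [lineSubmodule, hBi, ← hc, LinearMap.mem_ker, LinearMap.smul_apply, smul_eq_zero_iff_eq,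
    dotProductEquiv_apply_apply]

theorem Represents.cross_eq_zero_iff (hv : Represents v B) {i j : Fin n} :
    v i ⨯₃ v j = 0 ↔ B i = B j := by
  obtain ⟨hi, hBi⟩ := hv i
  obtain ⟨hj, hBj⟩ := hv j
  rw [← Projectivization.mk_eq_mk_iff_crossProduct_eq_zero (hv.ne_zero i) (hv.ne_zero j), hBi, hBj,
    Projectivization.mk_eq_mk_iff', Projectivization.mk_eq_mk_iff']
  simp only [← map_smul, EmbeddingLike.apply_eq_iff_eq]

theorem Represents.pairwise_cross_ne_zero_iff (hv : Represents v B) :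
    (Pairwise fun i j => v i ⨯₃ v j ≠ 0) ↔ Function.Injective B := by
  simp only [Ne, hv.cross_eq_zero_iff]
  exact Function.injective_iff_pairwise_ne.symm

theorem finrank_lineSubmodule (L : DualPlane) : Module.finrank ℂ (lineSubmodule L) = 2 := by
  have h := Module.Dual.finrank_ker_add_one_of_ne_zero L.rep_nonzero
  rw [Module.finrank_fin_fun] at h
  exact Nat.succ.inj h

theorem Represents.finrank_iInf_pos_iff (hv : Represents v B) {S : Finset (Fin n)} :
    0 < Module.finrank ℂ (⨅ i ∈ S, lineSubmodule (B i) : Submodule ℂ (Fin 3 → ℂ)) ↔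
      ∃ x ≠ 0, ∀ i ∈ S, v i ⬝ᵥ x = 0 := by
  rw [Module.finrank_pos_iff, Submodule.nontrivial_iff_ne_bot, Submodule.ne_bot_iff]
  simp only [Submodule.mem_iInf, hv.mem_lineSubmodule_iff, and_comm]

theorem finrank_iInf_le_one {S : Finset (Fin n)} {i j : Fin n} (hi : i ∈ S) (hj : j ∈ S)
    (hij : B i ≠ B j) :
    Module.finrank ℂ (⨅ k ∈ S, lineSubmodule (B k) : Submodule ℂ (Fin 3 → ℂ)) ≤ 1 := by
  obtain ⟨v, hv⟩ := exists_represents B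
  have hcross : v i ⨯₃ v j ≠ 0 := hv.cross_eq_zero_iff.not.mpr hij
  have hle : (⨅ k ∈ S, lineSubmodule (B k)) ≤ ℂ ∙ (v i ⨯₃ v j) := by
    intro x hx
    simp only [Submodule.mem_iInf, hv.mem_lineSubmodule_iff] at hx
    exact (mem_span_cross_iff hcross).mpr ⟨hx i hi, hx j hj⟩
  exact (Submodule.finrank_mono hle).trans (finrank_span_singleton hcross).le

theorem SameLattice.injective (h : SameLattice B C) (hC : Function.Injective C) :
    Function.Injective B := by
  intro i j hij
  by_contra hne
  have hfinrank := h {i, j} (Finset.insert_nonempty _ _)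
  rw [Finset.iInf_insert, Finset.iInf_singleton, hij, inf_idem, finrank_lineSubmodule] at hfinrank
  have hle := finrank_iInf_le_one (S := {i, j}) (by simp) (by simp) (hC.ne hne)
  omega

theorem Represents.dotProduct_cross_eq_zero_iff (hv : Represents v B) {i j k : Fin n} :
    v i ⬝ᵥ v j ⨯₃ v k = 0 ↔ 0 < Module.finrank ℂ
      (⨅ l ∈ ({i, j, k} : Finset (Fin n)), lineSubmodule (B l) : Submodule ℂ (Fin 3 → ℂ)) := by
  simp [LineArrangement.dotProduct_cross_eq_zero_iff, hv.finrank_iInf_pos_iff]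

theorem Represents.sameLattice_iff (hv : Represents v B) (hw : Represents w C)
    (hB : Function.Injective B) (hC : Function.Injective C) :
    SameLattice B C ↔ SameIncidences v w := by
  constructor
  · intro h i j k
    rw [hv.dotProduct_cross_eq_zero_iff, hw.dotProduct_cross_eq_zero_iff,
      h _ (Finset.insert_nonempty _ _)]
  · intro h S hS
    obtain ⟨i, rfl⟩ | ⟨i, hi, j, hj, hij⟩ := hS.exists_eq_singleton_or_nontrivial
    · rw [Finset.iInf_singleton, Finset.iInf_singleton, finrank_lineSubmodule,
        finrank_lineSubmodule]
    · have hpos {u : Fin n → Fin 3 → ℂ} {D : LineTuple n} (hu : Represents u D) :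
          0 < Module.finrank ℂ (⨅ l ∈ S, lineSubmodule (D l) : Submodule ℂ (Fin 3 → ℂ)) ↔
            ∀ i ∈ S, ∀ j ∈ S, ∀ k ∈ S, u i ⬝ᵥ u j ⨯₃ u k = 0 := by
        simpa [← hu.finrank_iInf_pos_iff] using
          exists_ne_zero_forall_dotProduct_eq_zero_iff (S := u '' S)
      have hvw : (∀ i ∈ S, ∀ j ∈ S, ∀ k ∈ S, v i ⬝ᵥ v j ⨯₃ v k = 0) ↔
          ∀ i ∈ S, ∀ j ∈ S, ∀ k ∈ S, w i ⬝ᵥ w j ⨯₃ w k = 0 := by simp only [h _ _ _]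
      have hBC := (hpos hv).trans (hvw.trans (hpos hw).symm)
      have hB1 := finrank_iInf_le_one hi hj (hB.ne hij)
      have hC1 := finrank_iInf_le_one hi hj (hC.ne hij)
      omega

end Represents

section ProjectiveEquivalence

variable {n : ℕ} {v : Fin n → Fin 3 → ℂ} {A B B' : LineTuple n} {g : GL (Fin 3) ℂ}

theorem mk_mem_linePoints_iff {L : DualPlane} {x : Fin 3 → ℂ} (hx : x ≠ 0) :
    (Projectivization.mk ℂ x hx : Plane) ∈ linePoints L ↔ x ∈ lineSubmodule L := by
  obtain ⟨c, hc⟩ := Projectivization.exists_smul_eq_mk_rep ℂ x hx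
  rw [linePoints, Set.mem_ofPred_eq, ← hc]
  exact (lineSubmodule L).smul_mem_iff c.ne_zero

theorem Represents.lineSubmodule_eq_comap (hv : Represents v B)
    (hv' : Represents (fun i => v i ᵥ* g.1) B') (i : Fin n) :
    lineSubmodule (B' i) = (lineSubmodule (B i)).comap
      (Matrix.GeneralLinearGroup.toLin g).toLinearEquiv.toLinearMap := by
  ext x
  rw [hv'.mem_lineSubmodule_iff, ← Matrix.dotProduct_mulVec]
  exact hv.mem_lineSubmodule_iff.symm

theorem Represents.sameLattice_of_vecMul (hv : Represents v B)
    (hv' : Represents (fun i => v i ᵥ* g.1) B') : SameLattice B' B := by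
  intro S _
  have hcomap : ⨅ i ∈ S, lineSubmodule (B' i) = (⨅ i ∈ S, lineSubmodule (B i)).comap
      (Matrix.GeneralLinearGroup.toLin g).toLinearEquiv.toLinearMap := by
    simp only [Submodule.comap_iInf]
    exact iInf_congr fun i => iInf_congr fun _ => hv.lineSubmodule_eq_comap hv' i
  rw [hcomap, Submodule.comap_equiv_eq_map_symm, LinearEquiv.finrank_map_eq]

theorem Represents.image_smul_linePoints (hv : Represents v B)
    (hv' : Represents (fun i => v i ᵥ* g.1) B') (i : Fin n) :
    (fun p : Plane => (Matrix.ProjGenLinGroup.mk g : PGL(3, ℂ)) • p) '' linePoints (B' i) =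
      linePoints (B i) := by
  have hmem (p : Plane) : (Matrix.ProjGenLinGroup.mk g : PGL(3, ℂ)) • p ∈ linePoints (B i) ↔
      p ∈ linePoints (B' i) := by
    induction p using Projectivization.ind with
    | h x hx =>
      rw [mk_mem_linePoints_iff, hv.lineSubmodule_eq_comap hv' i]
      exact mk_mem_linePoints_iff _
  exact ((Set.preimage_eq_iff_eq_image (MulAction.bijective _)).mp (Set.ext hmem)).symm

theorem Represents.exists_vecMul {B : RealizationSpace A} (hv : Represents v B.1)
    (g : GL (Fin 3) ℂ) : ∃ B' : RealizationSpace A,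
      Represents (fun i => v i ᵥ* g.1) B'.1 ∧ (projectiveSetoid A).r B' B := by
  have hne (i : Fin n) : v i ᵥ* g.1 ≠ 0 := by
    rw [← Matrix.zero_vecMul g.1]
    exact (Matrix.vecMul_injective_of_isUnit g.isUnit).ne (hv.ne_zero i)
  obtain ⟨B', hB'⟩ := exists_lineTuple_represents hne
  have hlattice : SameLattice B' A := fun S hS =>
    (hv.sameLattice_of_vecMul hB' S hS).trans (B.2 S hS)
  exact ⟨⟨B', hlattice⟩, hB', Matrix.ProjGenLinGroup.mk g, hv.image_smul_linePoints hB'⟩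

end ProjectiveEquivalence

section Normalization

variable {n : ℕ} {v : Fin n → Fin 3 → ℂ} {A B : LineTuple n} {p : Plane}

theorem Represents.mem_linePoints_iff_dotProduct_cross_eq_zero (hv : Represents v A)
    (hA : Function.Injective A) {i j k : Fin n} (hij : i ≠ j) (hi : p ∈ linePoints (A i))
    (hj : p ∈ linePoints (A j)) : p ∈ linePoints (A k) ↔ v k ⬝ᵥ v i ⨯₃ v j = 0 := by
  simp only [linePoints, Set.mem_ofPred_eq, hv.mem_lineSubmodule_iff] at hi hj ⊢
  have hcross : v i ⨯₃ v j ≠ 0 := hv.pairwise_cross_ne_zero_iff.mpr hA hij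
  obtain ⟨c, hc⟩ := Submodule.mem_span_singleton.mp ((mem_span_cross_iff hcross).mpr ⟨hi, hj⟩)
  have hc0 : c ≠ 0 := by
    rintro rfl
    exact p.rep_nonzero (by rw [← hc, zero_smul])
  rw [← hc, dotProduct_smul, smul_eq_zero_iff_right hc0]

theorem SameLattice.exists_normalizedAt (hBA : SameLattice B A) (hA : Function.Injective A)
    (hp : 2 ≤ multiplicity A p) : ∃ v u, u ≠ 0 ∧ Represents v B ∧
      NormalizedAt {i | p ∈ linePoints (A i)} u v := by
  obtain ⟨w, hw⟩ := exists_represents A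
  obtain ⟨v, hv⟩ := exists_represents B
  obtain ⟨a, ha, b, hb, hab⟩ := (Set.one_lt_ncard (Set.toFinite _)).mp hp
  have hB := hBA.injective hA
  have hmem (i : Fin n) : p ∈ linePoints (A i) ↔ v i ⬝ᵥ v a ⨯₃ v b = 0 :=
    (hw.mem_linePoints_iff_dotProduct_cross_eq_zero hA hab ha hb).trans
      (((hv.sameLattice_iff hw hB hA).mp hBA i a b).symm)
  have hscale (i : Fin n) : ∃ c : ℂˣ, p ∉ linePoints (A i) → (c • v i) ⬝ᵥ v a ⨯₃ v b = 1 := by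
    by_cases hi : p ∈ linePoints (A i)
    · exact ⟨1, absurd hi⟩
    · have hne : v i ⬝ᵥ v a ⨯₃ v b ≠ 0 := mt (hmem i).mpr hi
      exact ⟨(Units.mk0 _ hne)⁻¹, fun _ => (smul_dotProduct _ _ _).trans (inv_mul_cancel₀ hne)⟩
  choose c hc using hscale
  refine ⟨fun i => c i • v i, v a ⨯₃ v b, hv.pairwise_cross_ne_zero_iff.mpr hB hab,
    hv.units_smul c, fun i hi => ?_, hc⟩
  rw [smul_dotProduct, (hmem i).mp hi, smul_zero]

end Normalization

section Deformation

theorem eventually_eval_lineMap_ne_zero {σ R : Type*} [CommRing R] [IsDomain R]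
    {p : MvPolynomial σ R} {x y : σ → R} {t₀ : R}
    (h : MvPolynomial.eval (AffineMap.lineMap x y t₀) p ≠ 0) :
    ∀ᶠ t : R in cofinite, MvPolynomial.eval (AffineMap.lineMap x y t) p ≠ 0 := by
  let q : Polynomial R := MvPolynomial.aeval (fun s => .X * .C (y s - x s) + .C (x s)) p
  have hq (t : R) : q.eval t = MvPolynomial.eval (AffineMap.lineMap x y t) p := by
    simp only [q, ← Polynomial.coe_aeval_eq_eval, ← MvPolynomial.aeval_eq_eval]
    rw [MvPolynomial.comp_aeval_apply]
    congr 2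
    ext s
    simp [AffineMap.pi_lineMap_apply, AffineMap.lineMap_apply_ring']
  have hq0 : q ≠ 0 := by
    intro hq0
    simp [← hq, hq0] at h
  refine (Polynomial.finite_setOfPred_isRoot hq0).subset fun t ht => ?_
  simpa [hq] using ht

variable {R : Type*} [CommRing R] [IsDomain R] {a b c a' b' c' : Fin 3 → R} {t₀ : R}

theorem eventually_lineMap_ne_zero {κ : Type*} {a a' : κ → R}
    (h : AffineMap.lineMap a a' t₀ ≠ 0) :
    ∀ᶠ t : R in cofinite, AffineMap.lineMap a a' t ≠ 0 := by
  obtain ⟨s, hs⟩ := Function.ne_iff.mp h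
  have hX := eventually_eval_lineMap_ne_zero (p := (.X s : MvPolynomial κ R)) (x := a) (y := a')
    (t₀ := t₀) (by rwa [MvPolynomial.eval_X])
  refine hX.mono fun t ht hzero => ?_
  simp [hzero] at ht

theorem eventually_dotProduct_cross_lineMap_ne_zero
    (h : AffineMap.lineMap a a' t₀ ⬝ᵥ
      AffineMap.lineMap b b' t₀ ⨯₃ AffineMap.lineMap c c' t₀ ≠ 0) :
    ∀ᶠ t : R in cofinite, AffineMap.lineMap a a' t ⬝ᵥ
      AffineMap.lineMap b b' t ⨯₃ AffineMap.lineMap c c' t ≠ 0 := by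
  have hdet (t : R) : MvPolynomial.eval (AffineMap.lineMap (Function.uncurry ![a, b, c])
      (Function.uncurry ![a', b', c']) t) (Matrix.mvPolynomialX (Fin 3) (Fin 3) R).det =
        AffineMap.lineMap a a' t ⬝ᵥ
          AffineMap.lineMap b b' t ⨯₃ AffineMap.lineMap c c' t := by
    rw [Matrix.vec3_dotProduct, cross_apply, Matrix.det_fin_three]
    simp only [Matrix.mvPolynomialX_apply, map_add, map_sub, map_mul, MvPolynomial.eval_X,
      AffineMap.pi_lineMap_apply, Function.uncurry, Matrix.cons_val]
    ring
  simp only [← hdet] at h ⊢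
  exact eventually_eval_lineMap_ne_zero h

theorem eventually_cross_lineMap_ne_zero
    (h : AffineMap.lineMap a a' t₀ ⨯₃ AffineMap.lineMap b b' t₀ ≠ 0) :
    ∀ᶠ t : R in cofinite, AffineMap.lineMap a a' t ⨯₃ AffineMap.lineMap b b' t ≠ 0 := by
  obtain ⟨w, hw⟩ := exists_dotProduct_ne_zero h
  rw [← AffineMap.lineMap_same_apply w t₀] at hw
  refine (eventually_dotProduct_cross_lineMap_ne_zero hw).mono fun t ht hzero => ?_
  rw [hzero, dotProduct_zero] at ht
  exact ht rfl

theorem eventually_sameIncidences_lineMap {ι K : Type*} [Finite ι] [Field K]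
    {v w : ι → Fin 3 → K} (h : ∀ i j k, v i ⬝ᵥ v j ⨯₃ v k = 0 → ∀ t : K,
      AffineMap.lineMap (v i) (w i) t ⬝ᵥ
        AffineMap.lineMap (v j) (w j) t ⨯₃ AffineMap.lineMap (v k) (w k) t = 0) :
    ∀ᶠ t : K in cofinite, SameIncidences (fun i => AffineMap.lineMap (v i) (w i) t) v := by
  refine eventually_all.mpr fun i => eventually_all.mpr fun j => eventually_all.mpr fun k => ?_
  by_cases hijk : v i ⬝ᵥ v j ⨯₃ v k = 0
  · exact .of_forall fun t => iff_of_true (h i j k hijk t) hijk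
  · refine (eventually_dotProduct_cross_lineMap_ne_zero (t₀ := 0) ?_).mono
      fun t ht => iff_of_false ht hijk
    simpa only [AffineMap.lineMap_apply_zero]

end Deformation

section Topology

variable {n : ℕ} {v w : Fin n → Fin 3 → ℂ} {A B : LineTuple n}

theorem Represents.eval_coords_eq_zero_iff (hv : Represents v B)
    {p : MvPolynomial (Fin n × Fin 3) ℂ} (hp : IsMultihomogeneous p) :
    MvPolynomial.eval (coords B) p = 0 ↔ MvPolynomial.eval (Function.uncurry v) p = 0 := by
  rw [LineArrangement.eval_coords_eq_zero_iff hp B _ (fun i => (hv i).1) fun i => (hv i).2]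
  simp only [dotProductEquiv_apply_apply, dotProduct_single_one]
  rfl

theorem exists_eval_ne_zero_of_mem_nhds {U : Set (LineTuple n)} (hU : U ∈ 𝓝 B) :
    ∃ p : MvPolynomial (Fin n × Fin 3) ℂ, IsMultihomogeneous p ∧
      MvPolynomial.eval (coords B) p ≠ 0 ∧ ∀ D, MvPolynomial.eval (coords D) p ≠ 0 → D ∈ U := by
  obtain ⟨V, hVU, ⟨S, hS, hSV⟩, hBV⟩ := mem_nhds_iff.mp hU
  rw [← compl_compl V, hSV] at hVU hBV
  have hB : ∃ p ∈ S, MvPolynomial.eval (coords B) p ≠ 0 := by simpa [zeroLocus] using hBV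
  obtain ⟨p, hpS, hpB⟩ := hB
  exact ⟨p, hS p hpS, hpB, fun D hD => hVU fun hDS => hD (hDS p hpS)⟩

theorem Represents.eventually_mem_of_mem_nhds {t₀ : ℂ}
    (hB : Represents (fun i => AffineMap.lineMap (v i) (w i) t₀) B) {U : Set (LineTuple n)}
    (hU : U ∈ 𝓝 B) :
    ∀ᶠ t : ℂ in cofinite, ∀ D,
      Represents (fun i => AffineMap.lineMap (v i) (w i) t) D → D ∈ U := by
  obtain ⟨p, hp, hpB, hpU⟩ := exists_eval_ne_zero_of_mem_nhds hU
  have huncurry (t : ℂ) : Function.uncurry (fun i => AffineMap.lineMap (v i) (w i) t) =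
      AffineMap.lineMap (Function.uncurry v) (Function.uncurry w) t := by
    ext ⟨i, j⟩
    simp [AffineMap.pi_lineMap_apply]
  rw [Ne, hB.eval_coords_eq_zero_iff hp, huncurry] at hpB
  refine (eventually_eval_lineMap_ne_zero hpB).mono fun t ht D hD => hpU D ?_
  rwa [Ne, hD.eval_coords_eq_zero_iff hp, huncurry]

theorem nhds_inf_nhds_neBot_of_lineMap (hA : Function.Injective A) {B C : RealizationSpace A}
    (hv : Represents v B.1) (hw : Represents w C.1)
    (h : ∀ i j k, v i ⬝ᵥ v j ⨯₃ v k = 0 → ∀ t : ℂ,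
      AffineMap.lineMap (v i) (w i) t ⬝ᵥ
        AffineMap.lineMap (v j) (w j) t ⨯₃ AffineMap.lineMap (v k) (w k) t = 0) :
    (𝓝 B ⊓ 𝓝 C).NeBot := by
  refine inf_neBot_iff.mpr fun {U} hU {V} hV => ?_
  obtain ⟨U', hU', hUU'⟩ := mem_nhds_subtype _ _ _ |>.mp hU
  obtain ⟨V', hV', hVV'⟩ := mem_nhds_subtype _ _ _ |>.mp hV
  have hB := B.2.injective hA
  have hne : ∀ᶠ t : ℂ in cofinite, ∀ i, AffineMap.lineMap (v i) (w i) t ≠ 0 :=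
    eventually_all.mpr fun i => eventually_lineMap_ne_zero (t₀ := 0)
      (by simpa using hv.ne_zero i)
  have hcross : ∀ᶠ t : ℂ in cofinite, Pairwise fun i j =>
      AffineMap.lineMap (v i) (w i) t ⨯₃ AffineMap.lineMap (v j) (w j) t ≠ 0 := by
    simp only [Pairwise, eventually_all]
    intro i j hij
    refine eventually_cross_lineMap_ne_zero (t₀ := 0) ?_
    simpa using hv.pairwise_cross_ne_zero_iff.mpr hB hij
  obtain ⟨t, hne, hcross, hincidences, hU', hV'⟩ := (hne.and <| hcross.and <|
    (eventually_sameIncidences_lineMap h).and <|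
      (Represents.eventually_mem_of_mem_nhds (t₀ := 0) (by simpa using hv) hU').and <|
        Represents.eventually_mem_of_mem_nhds (t₀ := 1) (by simpa using hw) hV').exists
  obtain ⟨D, hD⟩ := exists_lineTuple_represents hne
  have hDB : SameLattice D B.1 := (hD.sameLattice_iff hv
    (hD.pairwise_cross_ne_zero_iff.mp hcross) hB).mpr hincidences
  exact ⟨⟨D, fun S hS => (hDB S hS).trans (B.2 S hS)⟩, hUU' (hU' D hD), hVV' (hV' D hD)⟩

theorem preirreducibleSpace_of_forall_nhds_inf_nhds_neBot {X : Type*} [TopologicalSpace X]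
    (h : ∀ x y : X, (𝓝 x ⊓ 𝓝 y).NeBot) : PreirreducibleSpace X := by
  refine .of_forall_nonempty_inter ?_
  rintro U V hU hV ⟨x, hx⟩ ⟨y, hy⟩
  exact inf_neBot_iff.mp (h x y) (hU.mem_nhds hx) (hV.mem_nhds hy)

end Topology

theorem exists_equivalent_nhds_inf_nhds_neBot {n : ℕ} {A : LineTuple n} (hA : Function.Injective A)
    {p : Plane} (hp : 2 ≤ multiplicity A p) (hpn : n ≤ multiplicity A p + 4)
    (B C : RealizationSpace A) :
    ∃ B' : RealizationSpace A, (projectiveSetoid A).r B' B ∧ (𝓝 B' ⊓ 𝓝 C).NeBot := by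
  have hP : ({i | p ∈ linePoints (A i)}ᶜ : Set (Fin n)).encard ≤ 4 := by
    have hcard := Set.ncard_add_ncard_compl {i | p ∈ linePoints (A i)}
    rw [Nat.card_eq_fintype_card, Fintype.card_fin] at hcard
    rw [← (Set.toFinite _).cast_ncard_eq]
    rw [multiplicity] at hpn
    exact_mod_cast (by omega : _ ≤ 4)
  obtain ⟨v, u, hu, hvB, hv⟩ := B.2.exists_normalizedAt hA hp
  obtain ⟨w, u', hu', hwC, hw⟩ := C.2.exists_normalizedAt hA hp
  have hB := B.2.injective hA
  have hC := C.2.injective hA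
  have hBC : SameLattice B.1 C.1 := fun S hS => (B.2 S hS).trans (C.2 S hS).symm
  obtain ⟨g, hg, m, hm⟩ := hv.exists_generalLinearGroup hw hu hu'
    ((hvB.sameLattice_iff hwC hB hC).mp hBC) hP
  obtain ⟨B', hvB', hB'B⟩ := hvB.exists_vecMul g
  have hB' := B'.2.injective hA
  have hB'C : SameLattice B'.1 C.1 := fun S hS => (B'.2 S hS).trans (C.2 S hS).symm
  obtain ⟨c, hc⟩ := (hv.vecMul hg).exists_units_smul_lineMap hu' hw
    (hvB'.pairwise_cross_ne_zero_iff.mpr hB') (hwC.pairwise_cross_ne_zero_iff.mpr hC)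
    ((hvB'.sameLattice_iff hwC hB' hC).mp hB'C) hm
  exact ⟨B', hB'B, nhds_inf_nhds_neBot_of_lineMap hA hvB' (hwC.units_smul c) hc⟩

end LineArrangement

theorem mainTheorem6_general {n : ℕ} (A : LineArrangement.LineTuple n) (hA : Function.Injective A)
    {p : LineArrangement.Plane} (hp : 2 ≤ LineArrangement.multiplicity A p)
    (hpn : n ≤ LineArrangement.multiplicity A p + 4) :
    IrreducibleSpace (LineArrangement.ModuliSpace A) := by
  have hnonempty : Nonempty (LineArrangement.ModuliSpace A) := ⟨⟦⟨A, fun _ _ => rfl⟩⟧⟩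
  have hpreirreducible : PreirreducibleSpace (LineArrangement.ModuliSpace A) := by
    refine LineArrangement.preirreducibleSpace_of_forall_nhds_inf_nhds_neBot
      (Quotient.ind₂ fun B C => ?_)
    obtain ⟨B', hB'B, hne⟩ :=
      LineArrangement.exists_equivalent_nhds_inf_nhds_neBot hA hp hpn B C
    rw [← Quotient.sound hB'B]
    exact ((continuous_quotient_mk'.tendsto B').inf (continuous_quotient_mk'.tendsto C)).neBot
  exact ⟨hnonempty⟩

theorem mainTheorem6 (A : LineArrangement.LineTuple 10) (hA : Function.Injective A)
    (hmult : ∃ p : LineArrangement.Plane, 6 ≤ LineArrangement.multiplicity A p) :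
    IrreducibleSpace (LineArrangement.ModuliSpace A) := by
  obtain ⟨p, hp⟩ := hmult
  exact mainTheorem6_general A hA (p := p) (by omega) (by omega)
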